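/- **Conventions.** Let $(E,d)$ be a metric space with its Borel $\sigma$-algebra, let $\Delta>0$, and let $\lambda$ be Lebesgue measure. A *geodesic* from $x$ to $y$ is a continuous map $\gamma:[0,d(x,y)]\to E$ with $\gamma(0)=x$, $\gamma(d(x,y))=y$ and length $d(x,y)$; $E$ is *geodesic* if any two points are joined by a geodesic. A *constant-speed geodesic* from $x$ to $y$ is a map $\gamma:[0,1]\to E$ with $\gamma(0)=x$, $\gamma(1)=y$ and $d(\gamma(s),\gamma(t))=|s-t|\,d(x,y)$ for all $s,t\in[0,1]$. A map $F:I\to E$ on an interval $I$ is *Lebesgue measurable* if preimages of Borel sets belong to the Lebesgue completion of the Borel $\sigma$-algebra of $I$. A *$\Delta$-subdivision* is a Lebesgue-measurable map $F:I\to E$ on a bounded interval $I$ with $\sup I-\inf I=\Delta$ whose image has finite diameter. A *TVPD* $P$ is a function from a finite union $I_1^P\cup\dots\cup I_{N_P}^P$ ($N_P\ge 1$) of pairwise disjoint intervals to $E$, where every point of $I_i^P$ lies to the left of every point of $I_{i'}^P$ if $i<i'$, such that every restriction $P|_{I_i^P}$ is a $\Delta$-subdivision. **Theorem.** Let $(E,d)$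 be a geodesic Polish space and $\Delta>0$. (1) Let $P,Q$ be TVPDs, $i\in\{1,\dots,N_P\}$, $j\in\{1,\dots,N_Q\}$, and write $a_i=\inf I_i^P$, $b_i=\sup I_i^P$, $c_j=\inf I_j^Q$, $d_j=\sup I_j^Q$. There is a choice $(x,y)\mapsto\mathcal G(x,y)$ of a constant-speed geodesic from $x$ to $y$ for all $x,y\in E$ such that, for every $T\in(0,1)$ and every interval $I_{i,j}^T$ with $\inf I_{i,j}^T=(1-T)a_i+Tc_j$ and $\sup I_{i,j}^T=(1-T)b_i+Td_j$, there is a $\Delta$-subdivision $G_{i,j}^T:I_{i,j}^T\to E$ with $$G_{i,j}^T(t+\inf I_{i,j}^T-a_i)=\mathcal G\bigl(P(t),Q(t+c_j-a_i)\bigr)(T)\qquad\text{for }\lambda\text{-almost every }t\in I_i^P.$$ (2) Let $A\subset E$ be closed and such that $\{y\in A: d(x,y)=d(x,A)\}\neq\emptyset$ for all $x\in E$, where $d(x,A)=\inf_{y\in A}d(x,y)$. Let $P$ be a TVPD and $i\in\{1,\dots,N_P\}$. There is a Lebesgue-measurable map $p^i:I_i^P\to E$ such that, for $\lambda$-almost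 every $t\in I_i^P$, $p^i(t)\in A$ and $d(P(t),p^i(t))=d(P(t),A)$. Moreover, for every such $p^i$ there is a choice $(x,y)\mapsto\mathcal G(x,y)$ of a constant-speed geodesic from $x$ to $y$ for all $x,y\in E$ such that, for every $T\in(0,1)$, there is a $\Delta$-subdivision $G_i^T:I_i^P\to E$ with $$G_i^T(t)=\mathcal G\bigl(P(t),p^i(t)\bigr)(T)\qquad\text{for }\lambda\text{-almost every }t\in I_i^P.$$ -/

import Mathlib

open MeasureTheory Set

/-- A geodesic of a metric space joining `x` to `y`: a map `γ`, continuous on `[0, d(x, y)]`, with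
`γ 0 = x` and `γ (d(x, y)) = y`, whose length (the supremum of `∑ d(γ tₖ, γ tₖ₊₁)` over all
subdivisions of `[0, d(x, y)]`) is `d(x, y)`. Only the values of `γ` on `[0, d(x, y)]` matter. -/
structure IsGeodesicBetween {E : Type*} [MetricSpace E] (x y : E) (γ : ℝ → E) : Prop where
  continuousOn : ContinuousOn γ (Icc 0 (dist x y))
  source : γ 0 = x
  target : γ (dist x y) = y
  length_eq : eVariationOn γ (Icc 0 (dist x y)) = ENNReal.ofReal (dist x y)

/-- A metric space is geodesic if every pair of points is joined by at least one geodesic. -/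
def IsGeodesicSpace (E : Type*) [MetricSpace E] : Prop :=
  ∀ x y : E, ∃ γ : ℝ → E, IsGeodesicBetween x y γ

/-- A constant-speed geodesic from `x` to `y`, parametrised by `[0, 1]`. Only the values of `γ`
on `[0, 1]` matter. -/
structure IsConstSpeedGeodesic {E : Type*} [MetricSpace E] (x y : E) (γ : ℝ → E) : Prop where
  source : γ 0 = x
  target : γ 1 = y
  dist_eq : ∀ s ∈ Icc (0 : ℝ) 1, ∀ t ∈ Icc (0 : ℝ) 1, dist (γ s) (γ t) = |s - t| * dist x y

/-- The restriction of `F` to `I` is a `Δ`-subdivision: `I` is a bounded interval of length `Δ`,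
`F` is Lebesgue measurable on `I` (that is, measurable from the Lebesgue completion of the Borel
sets of `I` to the Borel sets of `E`), and the image of `I` under `F` has finite diameter.
Only the values of `F` on `I` matter. -/
structure IsDeltaSubdivision {E : Type*} [MetricSpace E] [MeasurableSpace E]
    (Δ : ℝ) (I : Set ℝ) (F : ℝ → E) : Prop where
  nonempty : I.Nonempty
  ordConnected : I.OrdConnected
  bddBelow : BddBelow I
  bddAbove : BddAbove I
  length_eq : sSup I - sInf I = Δ
  measurable : NullMeasurable F (volume.restrict I)
  bounded : Bornology.IsBounded (F '' I)

/-- A time-varying persistence diagram with values in `E` and step `Δ` (in the relaxed sense, in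
which the values may meet the reference set of the edit distance): a function on a finite
non-empty union of disjoint, increasingly ordered intervals, whose restriction to each of these
intervals is a `Δ`-subdivision. Only the values of `toFun` on the union matter. -/
structure TVPD (E : Type*) [MetricSpace E] [MeasurableSpace E] (Δ : ℝ) where
  N : ℕ
  N_pos : 0 < N
  I : Fin N → Set ℝ
  toFun : ℝ → E
  disjoint : ∀ i i', i ≠ i' → Disjoint (I i) (I i')
  ordered : ∀ i i', i < i' → ∀ x ∈ I i, ∀ x' ∈ I i', x < x'
  subdivision : ∀ i, IsDeltaSubdivision Δ (I i) toFun

/-- `p` is a Lebesgue-measurable map on `I` which sends almost every `t ∈ I` to a point of `A`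
nearest to `F t`. -/
structure IsNearestPointSelection {E : Type*} [MetricSpace E] [MeasurableSpace E]
    (A : Set E) (I : Set ℝ) (F p : ℝ → E) : Prop where
  measurable : NullMeasurable p (volume.restrict I)
  nearest : ∀ᵐ t ∂(volume.restrict I), p t ∈ A ∧ dist (F t) (p t) = Metric.infDist (F t) A

section

open Filter Topology
open scoped ENNReal

/-! ### Measurable sections of continuous surjections, up to a null set -/

/-! Bounds on images follow from the triangle inequality; the issue is measurability, since
geodesics and nearest points need not be unique. Constant-speed geodesics form a closed subset of
C([0,1], E), hence a Polish space, and the endpoint map onto E × E is a continuous surjection. A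
measurable section of it, valid almost everywhere for the law of the pair of maps, gives one choice
`𝒢` that serves every T, because evaluation at T is continuous. Nearest points arise in the same way
from the first projection of the closed set of pairs (x, y) with y ∈ A nearest to x.

The section (`exists_measurable_ae_section`) is built by parametrising the source by the Baire
space, finding compact sets there whose images have nearly full measure
(`exists_isCompact_measure_compl_image_le`), and selecting over each compact set, a continuous image
of the Cantor set, the least point of the fibre. -/

/-- A continuous map on a compact set has a measurable section over its image. -/
theorem IsCompact.exists_measurable_section {X Y : Type*} [TopologicalSpace X]
    [TopologicalSpace.MetrizableSpace X] [MeasurableSpace X] [BorelSpace X] [TopologicalSpace Y]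
    [T2Space Y] [MeasurableSpace Y] [OpensMeasurableSpace Y] {K : Set X} (hK : IsCompact K)
    (hne : K.Nonempty) {f : X → Y} (hf : Continuous f) :
    ∃ s : Y → X, Measurable s ∧ ∀ y ∈ f '' K, f (s y) = y := by
  let := TopologicalSpace.metrizableSpaceMetric X
  have : CompactSpace K := isCompact_iff_compactSpace.1 hK
  have : Nonempty K := hne.to_subtype
  obtain ⟨g, hg, hgs⟩ := exists_nat_bool_continuous_surjective_of_compact K
  set φ : cantorSet → X := fun c ↦ (g (cantorSetHomeomorphNatToBool c) : X) with hφdef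
  have hφ : Continuous φ := by
    exact continuous_subtype_val.comp (hg.comp cantorSetHomeomorphNatToBool.continuous)
  have : CompactSpace cantorSet := isCompact_iff_compactSpace.1 isCompact_cantorSet
  set h : cantorSet → Y := f ∘ φ with hhdef
  have hh : Continuous h := hf.comp hφ
  -- The fibre is compact in ℝ, so its least element is a canonical choice; an empty fibre yields
  -- `sInf ∅ = 0`, which also lies in the Cantor set.
  set S : Y → Set ℝ := fun y ↦ Subtype.val '' (h ⁻¹' {y}) with hS
  have hSc : ∀ y, IsCompact (S y) := fun y ↦
    ((isClosed_singleton.preimage hh).isCompact).image continuous_subtype_val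
  have hS0 : ∀ y, ∀ c ∈ S y, 0 ≤ c := by
    rintro y _ ⟨c, -, rfl⟩
    exact (cantorSet_subset_unitInterval c.2).1
  have hmem : ∀ y ∈ range h, sInf (S y) ∈ S y := by
    rintro _ ⟨c, rfl⟩
    exact (hSc _).sInf_mem ⟨c, c, rfl, rfl⟩
  have hempty : ∀ y ∉ range h, sInf (S y) = 0 := by
    intro y hy
    have : S y = ∅ := by
      rw [eq_empty_iff_forall_notMem]
      rintro _ ⟨c, hc, -⟩
      exact hy ⟨c, hc⟩
    rw [this, Real.sInf_empty]
  have hcantor : ∀ y, sInf (S y) ∈ cantorSet := by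
    intro y
    by_cases hy : y ∈ range h
    · obtain ⟨c, -, hc⟩ := hmem y hy
      exact hc ▸ c.2
    · rw [hempty y hy]; exact zero_mem_cantorSet
  have hmeas : Measurable fun y ↦ sInf (S y) := by
    refine measurable_of_Iic fun a ↦ ?_
    rcases lt_or_ge a 0 with ha | ha
    · convert MeasurableSet.empty
      rw [eq_empty_iff_forall_notMem]
      intro y hy
      exact absurd (Real.sInf_nonneg (hS0 y)) (not_le.2 (lt_of_le_of_lt hy ha))
    · have : (fun y ↦ sInf (S y)) ⁻¹' Iic a = h '' {c | (c : ℝ) ≤ a} ∪ (range h)ᶜ := by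
        ext y
        constructor
        · intro hy
          by_cases hr : y ∈ range h
          · obtain ⟨c, hc, hca⟩ := hmem y hr
            exact Or.inl ⟨c, hca.trans_le hy, hc⟩
          · exact Or.inr hr
        · rintro (⟨c, hc, rfl⟩ | hr)
          · exact (csInf_le ⟨0, hS0 _⟩ ⟨c, rfl, rfl⟩ : sInf (S (h c)) ≤ c).trans hc
          · exact (hempty y hr).trans_le ha
      rw [this]
      refine MeasurableSet.union ?_ ?_
      · exact ((isClosed_le continuous_subtype_val continuous_const).isCompact.image
          hh).measurableSet
      · exact (isCompact_range hh).measurableSet.compl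
  refine ⟨fun y ↦ φ ⟨sInf (S y), hcantor y⟩, hφ.measurable.comp (hmeas.subtype_mk), ?_⟩
  rintro _ ⟨x, hx, rfl⟩
  have hr : f x ∈ range h := by
    obtain ⟨b, hb⟩ := hgs ⟨x, hx⟩
    refine ⟨cantorSetHomeomorphNatToBool.symm b, ?_⟩
    simp [hhdef, hφdef, hb]
  obtain ⟨c, hc, hca⟩ := hmem _ hr
  have : (⟨sInf (S (f x)), hcantor _⟩ : cantorSet) = c := Subtype.ext hca.symm
  exact (congrArg h this).trans hc

/-- Inner regularity of a continuous image of the Baire space with respect to images of compact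
sets. -/
theorem exists_isCompact_measure_compl_image_le {Y : Type*} [MetricSpace Y] [MeasurableSpace Y]
    [BorelSpace Y] {f : (ℕ → ℕ) → Y} (hf : Continuous f) (hs : Function.Surjective f)
    (μ : Measure Y) [IsFiniteMeasure μ] {ε : ℝ≥0∞} (hε : ε ≠ 0) :
    ∃ K : Set (ℕ → ℕ), IsCompact K ∧ K.Nonempty ∧ μ (f '' K)ᶜ ≤ ε := by
  obtain ⟨δ, hδ, hδε⟩ := ENNReal.exists_pos_sum_of_countable' hε ℕ
  -- Bounding one more coordinate costs at most `δ k`: continuity from below holds for outer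
  -- measure, so these images need not be measurable.
  have step : ∀ (B : Set (ℕ → ℕ)) (k : ℕ),
      ∃ n : ℕ, μ (f '' B) ≤ μ (f '' (B ∩ {x | x k ≤ n})) + δ k := by
    intro B k
    have hmono : Monotone fun n : ℕ ↦ f '' (B ∩ {x | x k ≤ n}) := fun m n hmn ↦
      image_mono (inter_subset_inter_right _ fun x (hx : x k ≤ m) ↦ hx.trans hmn)
    have hU : ⋃ n : ℕ, f '' (B ∩ {x | x k ≤ n}) = f '' B := by
      rw [← image_iUnion, ← inter_iUnion]
      congr 1
      exact inter_eq_left.2 fun x _ ↦ mem_iUnion.2 ⟨x k, le_refl (x k)⟩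
    by_contra! hcon
    have h1 : μ (f '' B) = ⨆ n : ℕ, μ (f '' (B ∩ {x | x k ≤ n})) := by
      rw [← hU, hmono.measure_iUnion]
    have h0 : μ (f '' B) ≠ 0 := (bot_le.trans_lt (hcon 0)).ne'
    have h2 : μ (f '' B) ≤ μ (f '' B) - δ k := by
      nth_rw 1 [h1]
      exact iSup_le fun n ↦ ENNReal.le_sub_of_add_le_right
        (ne_top_of_lt ((le_add_self).trans_lt (hcon n))) (hcon n).le
    exact absurd h2 (not_le.2 (ENNReal.sub_lt_self (measure_ne_top _ _) h0 (hδ k).ne'))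
  choose n hn using step
  let S : ℕ → Set (ℕ → ℕ) := fun k ↦ Nat.rec univ (fun k B ↦ B ∩ {x | x k ≤ n B k}) k
  have hSs : ∀ k, S (k + 1) = S k ∩ {x | x k ≤ n (S k) k} := fun k ↦ rfl
  let N : ℕ → ℕ := fun k ↦ n (S k) k
  have hSmem : ∀ k, ∀ x ∈ S k, ∀ i < k, x i ≤ N i := by
    intro k
    induction k with
    | zero => intro x _ i hi; omega
    | succ k ih =>
      intro x hx i hi
      rw [hSs] at hx
      rcases Nat.lt_succ_iff_lt_or_eq.1 hi with h | rfl
      · exact ih x hx.1 i h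
      · exact hx.2
  have hSμ : ∀ k, μ univ ≤ μ (f '' S k) + ∑ i ∈ Finset.range k, δ i := by
    intro k
    induction k with
    | zero => simp [S, hs.range_eq]
    | succ k ih =>
      rw [Finset.sum_range_succ, hSs]
      calc μ univ ≤ μ (f '' S k) + ∑ i ∈ Finset.range k, δ i := ih
        _ ≤ (μ (f '' (S k ∩ {x | x k ≤ n (S k) k})) + δ k) + ∑ i ∈ Finset.range k, δ i := by
          gcongr; exact hn _ _
        _ = _ := by ring
  have hSanti : Antitone S := antitone_nat_of_succ_le fun k ↦ by
    rw [hSs]; exact inter_subset_left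
  let K : Set (ℕ → ℕ) := Set.pi univ fun i ↦ Iic (N i)
  have hK : IsCompact K := isCompact_univ_pi fun i ↦ (finite_Iic (N i)).isCompact
  -- Continuity from above does need measurable sets, hence the closures; compactness of `K` keeps
  -- their intersection inside `f '' K`.
  have hsub : ⋂ k, closure (f '' S k) ⊆ f '' K := by
    intro y hy
    have hx : ∀ k : ℕ, ∃ x ∈ S k, dist y (f x) < 1 / ((k : ℝ) + 1) := by
      intro k
      obtain ⟨_, ⟨x, hx, rfl⟩, hd⟩ := Metric.mem_closure_iff.1 (mem_iInter.1 hy k) _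
        (Nat.one_div_pos_of_nat (n := k) (α := ℝ))
      exact ⟨x, hx, hd⟩
    choose x hxS hxd using hx
    -- Only the first k coordinates of `x k` are bounded. Truncation puts the point in `K` and
    -- leaves coordinate i unchanged once k > i, so limits agree.
    let x' : ℕ → ℕ → ℕ := fun k i ↦ min (x k i) (N i)
    have hx' : ∀ k, x' k ∈ K := fun k i _ ↦ mem_Iic.2 (min_le_right _ _)
    obtain ⟨z, hz, ψ, hψ, hlim⟩ := hK.tendsto_subseq hx'
    have hlim2 : Tendsto (x ∘ ψ) atTop (𝓝 z) := by
      rw [tendsto_pi_nhds] at hlim ⊢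
      intro i
      refine (hlim i).congr' ?_
      filter_upwards [eventually_gt_atTop i] with k hk
      exact min_eq_left (hSmem _ _ (hxS _) i (hk.trans_le (hψ.id_le k)))
    have h1 : Tendsto (fun k ↦ f (x (ψ k))) atTop (𝓝 (f z)) := (hf.tendsto z).comp hlim2
    have h2 : Tendsto (fun k ↦ f (x k)) atTop (𝓝 y) := by
      rw [tendsto_iff_dist_tendsto_zero]
      refine squeeze_zero (fun _ ↦ dist_nonneg) (fun k ↦ ?_)
        tendsto_one_div_add_atTop_nhds_zero_nat
      rw [dist_comm]; exact (hxd k).le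
    exact ⟨z, hz, tendsto_nhds_unique h1 (h2.comp hψ.tendsto_atTop)⟩
  refine ⟨K, hK, ⟨0, fun i _ ↦ Nat.zero_le _⟩, ?_⟩
  have hcl : μ univ ≤ μ (f '' K) + ε := by
    calc μ univ ≤ (⨅ k, μ (closure (f '' S k))) + ε := by
          rw [ENNReal.iInf_add]
          refine le_iInf fun k ↦ (hSμ k).trans ?_
          gcongr
          · exact subset_closure
          · exact (ENNReal.sum_le_tsum _).trans hδε.le
      _ = μ (⋂ k, closure (f '' S k)) + ε := by
          rw [Antitone.measure_iInter]
          · exact fun k l hkl ↦ closure_mono (image_mono (hSanti hkl))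
          · exact fun k ↦ isClosed_closure.measurableSet.nullMeasurableSet
          · exact ⟨0, measure_ne_top _ _⟩
      _ ≤ μ (f '' K) + ε := by gcongr
  rw [measure_compl (hK.image hf).measurableSet (measure_ne_top _ _)]
  exact tsub_le_iff_left.2 hcl

/-- A continuous surjection of Polish spaces has a measurable section up to a null set of any
given finite measure. -/
theorem exists_measurable_ae_section {X Y : Type*} [TopologicalSpace X] [PolishSpace X]
    [MeasurableSpace X] [BorelSpace X] [MetricSpace Y] [MeasurableSpace Y] [BorelSpace Y]
    {f : X → Y} (hf : Continuous f) (hs : Function.Surjective f) (μ : Measure Y)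
    [IsFiniteMeasure μ] :
    ∃ s : Y → X, Measurable s ∧ ∀ᵐ y ∂μ, f (s y) = y := by
  classical
  rcases isEmpty_or_nonempty Y with hY | hY
  · exact ⟨isEmptyElim, measurable_of_empty _, ae_of_all _ isEmptyElim⟩
  have : Nonempty X := hs.nonempty
  obtain ⟨g, hg, hgs⟩ := PolishSpace.exists_nat_nat_continuous_surjective X
  have hfg : Continuous (f ∘ g) := hf.comp hg
  have hpos : ∀ n : ℕ, ((n : ℝ≥0∞) + 1)⁻¹ ≠ 0 := fun n ↦
    ENNReal.inv_ne_zero.2 (by finiteness)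
  choose K hK hKne hKμ using fun n : ℕ ↦
    exists_isCompact_measure_compl_image_le hfg (hs.comp hgs) μ (hpos n)
  choose s hsm hsf using fun n ↦ (hK n).exists_measurable_section (hKne n) hfg
  have hKm : ∀ n, MeasurableSet ((f ∘ g) '' K n) := fun n ↦ ((hK n).image hfg).measurableSet
  let U : Set Y := ⋃ n, (f ∘ g) '' K n
  -- Adding the null set `Uᶜ` makes the search for the first index total.
  have hex : ∀ y, ∃ n, y ∈ (f ∘ g) '' K n ∪ Uᶜ := by
    intro y
    by_cases hy : y ∈ U
    · obtain ⟨n, hn⟩ := mem_iUnion.1 hy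
      exact ⟨n, Or.inl hn⟩
    · exact ⟨0, Or.inr hy⟩
  have hUμ : μ Uᶜ = 0 := by
    have hlim : Tendsto (fun n : ℕ ↦ ((n : ℝ≥0∞) + 1)⁻¹) atTop (𝓝 0) := by
      have := (tendsto_add_atTop_iff_nat 1).2 ENNReal.tendsto_inv_nat_nhds_zero
      simpa using this
    refine le_antisymm (ge_of_tendsto' hlim fun n ↦ ?_) bot_le
    refine le_trans (measure_mono ?_) (hKμ n)
    exact compl_subset_compl.2 (subset_iUnion (fun n ↦ (f ∘ g) '' K n) n)
  refine ⟨fun y ↦ g (s (Nat.find (hex y)) y), hg.measurable.comp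
    (Measurable.find (p := fun n y ↦ y ∈ (f ∘ g) '' K n ∪ Uᶜ) hsm
      (fun n ↦ (hKm n).union (MeasurableSet.iUnion hKm).compl) hex), ?_⟩
  have hae : ∀ᵐ y ∂μ, y ∈ U := hUμ
  filter_upwards [hae] with y hy
  refine hsf _ _ ((Nat.find_spec (hex y)).resolve_right fun h ↦ h hy)

/-! ### Geodesics -/

namespace IsGeodesicBetween

variable {E : Type*} [MetricSpace E] {x y : E} {γ : ℝ → E}

/-- Length is additive over the three subintervals and dominates the distance between the endpoints
of each. -/
theorem dist_add_dist_add_dist_le (h : IsGeodesicBetween x y γ) {s t : ℝ} (hs : 0 ≤ s)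
    (hst : s ≤ t) (ht : t ≤ dist x y) :
    dist x (γ s) + dist (γ s) (γ t) + dist (γ t) y ≤ dist x y := by
  have key : edist (γ 0) (γ s) + edist (γ s) (γ t) + edist (γ t) (γ (dist x y)) ≤
      ENNReal.ofReal (dist x y) := by
    rw [← h.length_eq]
    have h1 := eVariationOn.Icc_add_Icc γ (s := univ) hs hst (mem_univ _)
    have h2 := eVariationOn.Icc_add_Icc γ (s := univ) (hs.trans hst) ht (mem_univ _)
    simp only [univ_inter] at h1 h2
    rw [← h2, ← h1]
    gcongr
    · exact eVariationOn.edist_le _ (left_mem_Icc.2 hs) (right_mem_Icc.2 hs)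
    · exact eVariationOn.edist_le _ (left_mem_Icc.2 hst) (right_mem_Icc.2 hst)
    · exact eVariationOn.edist_le _ (left_mem_Icc.2 ht) (right_mem_Icc.2 ht)
  rw [h.source, h.target] at key
  simp only [edist_dist] at key
  rwa [← ENNReal.ofReal_add dist_nonneg dist_nonneg, ← ENNReal.ofReal_add (by positivity)
    dist_nonneg, ENNReal.ofReal_le_ofReal_iff dist_nonneg] at key

theorem dist_eq_abs (h : IsGeodesicBetween x y γ) {s t : ℝ} (hs : s ∈ Icc 0 (dist x y))
    (ht : t ∈ Icc 0 (dist x y)) : dist (γ s) (γ t) = |dist x (γ s) - dist x (γ t)| := by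
  wlog hst : s ≤ t generalizing s t
  · rw [dist_comm, abs_sub_comm]
    exact this ht hs (le_of_not_ge hst)
  have h1 := h.dist_add_dist_add_dist_le hs.1 hst ht.2
  have h2 := dist_triangle x (γ t) y
  have h3 := dist_triangle x (γ s) (γ t)
  rw [abs_sub_comm, abs_of_nonneg] <;> linarith [dist_nonneg (x := γ s) (y := γ t)]

/-- The given parametrisation may have varying speed, so points are relabelled by their distance
from x, using the intermediate value theorem. By `dist_eq_abs` any choice of times `τ` works, with
no regularity required. -/
theorem exists_isConstSpeedGeodesic (h : IsGeodesicBetween x y γ) :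
    ∃ η : ℝ → E, IsConstSpeedGeodesic x y η := by
  have h0 : (0 : ℝ) ∈ Icc 0 (dist x y) := left_mem_Icc.2 dist_nonneg
  have hD : dist x y ∈ Icc 0 (dist x y) := right_mem_Icc.2 dist_nonneg
  have hcont : ContinuousOn (fun t ↦ dist x (γ t)) (Icc 0 (dist x y)) :=
    (continuous_const.dist continuous_id).comp_continuousOn h.continuousOn
  have hivt := intermediate_value_Icc dist_nonneg hcont
  simp only [h.source, h.target, dist_self] at hivt
  have hex : ∀ r : ℝ, ∃ t ∈ Icc 0 (dist x y), r ∈ Icc (0 : ℝ) 1 → dist x (γ t) = r * dist x y := by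
    intro r
    by_cases hr : r ∈ Icc (0 : ℝ) 1
    · obtain ⟨t, ht, hrt⟩ := hivt ⟨mul_nonneg hr.1 dist_nonneg,
        mul_le_of_le_one_left dist_nonneg hr.2⟩
      exact ⟨t, ht, fun _ ↦ hrt⟩
    · exact ⟨0, h0, fun h ↦ absurd h hr⟩
  choose τ hτ hτd using hex
  refine ⟨fun r ↦ γ (τ r), ?_, ?_, fun s hs t ht ↦ ?_⟩
  · have := hτd 0 (by simp)
    rw [zero_mul, dist_eq_zero] at this
    exact this.symm
  · have h1 := h.dist_eq_abs (hτ 1) hD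
    rw [hτd 1 (by simp), h.target, one_mul, sub_self, abs_zero, dist_eq_zero] at h1
    exact h1
  · rw [h.dist_eq_abs (hτ s) (hτ t), hτd s hs, hτd t ht, ← sub_mul, abs_mul,
      abs_of_nonneg (dist_nonneg (x := x) (y := y))]

end IsGeodesicBetween

theorem IsConstSpeedGeodesic.dist_le {E : Type*} [MetricSpace E] {x y : E} {γ : ℝ → E}
    (h : IsConstSpeedGeodesic x y γ) {t : ℝ} (ht : t ∈ Icc (0 : ℝ) 1) :
    dist (γ t) x ≤ dist x y := by
  have := h.dist_eq t ht 0 (by simp)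
  rw [h.source, sub_zero, abs_of_nonneg ht.1] at this
  rw [this]
  exact mul_le_of_le_one_left dist_nonneg ht.2

instance ContinuousMap.polishSpace {X Y : Type*} [TopologicalSpace X] [CompactSpace X]
    [SecondCountableTopology X] [LocallyCompactSpace X] [TopologicalSpace Y] [PolishSpace Y] :
    PolishSpace C(X, Y) := by
  let := TopologicalSpace.upgradeIsCompletelyMetrizable Y
  infer_instance

/-- The continuous maps on the unit interval which are constant-speed geodesics. -/
def constSpeedGeodesics (E : Type*) [MetricSpace E] : Set C(unitInterval, E) :=
  {γ | ∀ s t : unitInterval, dist (γ s) (γ t) = |(s : ℝ) - t| * dist (γ 0) (γ 1)}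

theorem isClosed_constSpeedGeodesics (E : Type*) [MetricSpace E] :
    IsClosed (constSpeedGeodesics E) := by
  simp only [constSpeedGeodesics, ofPred_forall]
  refine isClosed_iInter fun s ↦ isClosed_iInter fun t ↦ isClosed_eq ?_ ?_ <;> fun_prop

theorem isConstSpeedGeodesic_of_mem {E : Type*} [MetricSpace E] {γ : C(unitInterval, E)}
    (hγ : γ ∈ constSpeedGeodesics E) :
    IsConstSpeedGeodesic (γ 0) (γ 1) fun r ↦ γ (projIcc 0 1 zero_le_one r) where
  source := by rw [projIcc_left]; rfl
  target := by rw [projIcc_right]; rfl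
  dist_eq s hs t ht := by
    rw [projIcc_of_mem _ hs, projIcc_of_mem _ ht]
    exact hγ _ _

theorem IsConstSpeedGeodesic.exists_mem_constSpeedGeodesics {E : Type*} [MetricSpace E] {x y : E}
    {γ : ℝ → E} (h : IsConstSpeedGeodesic x y γ) :
    ∃ η ∈ constSpeedGeodesics E, η 0 = x ∧ η 1 = y := by
  have hlip : LipschitzWith (nndist x y) fun t : unitInterval ↦ γ t := by
    refine LipschitzWith.of_dist_le_mul fun s t ↦ ?_
    rw [h.dist_eq s s.2 t t.2, mul_comm, coe_nndist, Subtype.dist_eq, Real.dist_eq]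
  refine ⟨⟨fun t ↦ γ t, hlip.continuous⟩, fun s t ↦ ?_, ?_, ?_⟩
  · simpa [h.source, h.target] using h.dist_eq s s.2 t t.2
  · simpa using h.source
  · simpa using h.target

/-- In a geodesic Polish space, geodesics between the values of two measurable maps may be chosen
such that the resulting interpolations are measurable. -/
theorem IsGeodesicSpace.exists_geodesics_aemeasurable {E : Type*} [MetricSpace E] [PolishSpace E]
    [MeasurableSpace E] [BorelSpace E] (hE : IsGeodesicSpace E) {α : Type*} [MeasurableSpace α]
    {μ : Measure α} [IsFiniteMeasure μ] {f g : α → E} (hf : AEMeasurable f μ)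
    (hg : AEMeasurable g μ) :
    ∃ 𝒢 : E → E → ℝ → E, (∀ x y, IsConstSpeedGeodesic x y (𝒢 x y)) ∧
      ∀ T, AEMeasurable (fun t ↦ 𝒢 (f t) (g t) T) μ := by
  classical
  choose γ₀ hγ₀ using fun x y ↦ (hE x y).choose_spec.exists_isConstSpeedGeodesic
  let : MeasurableSpace (constSpeedGeodesics E) := borel _
  have : BorelSpace (constSpeedGeodesics E) := ⟨rfl⟩
  have : PolishSpace (constSpeedGeodesics E) := (isClosed_constSpeedGeodesics E).polishSpace
  let e : constSpeedGeodesics E → E × E := fun γ ↦ (γ.1 0, γ.1 1)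
  have he : Continuous e := by fun_prop
  have hes : Function.Surjective e := by
    rintro ⟨x, y⟩
    obtain ⟨η, hη, h0, h1⟩ := (hγ₀ x y).exists_mem_constSpeedGeodesics
    exact ⟨⟨η, hη⟩, Prod.ext h0 h1⟩
  obtain ⟨s, hsm, hs⟩ := exists_measurable_ae_section he hes (μ.map fun t ↦ (f t, g t))
  refine ⟨fun x y ↦ if e (s (x, y)) = (x, y) then
    fun r ↦ (s (x, y)).1 (projIcc 0 1 zero_le_one r) else γ₀ x y, fun x y ↦ ?_, fun T ↦ ?_⟩
  · dsimp only
    split_ifs with h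
    · have := isConstSpeedGeodesic_of_mem (s (x, y)).2
      rwa [show (s (x, y)).1 0 = x from congrArg Prod.fst h,
        show (s (x, y)).1 1 = y from congrArg Prod.snd h] at this
    · exact hγ₀ x y
  · have hev : Continuous fun γ : constSpeedGeodesics E ↦ γ.1 (projIcc 0 1 zero_le_one T) := by
      fun_prop
    refine ((hev.measurable.comp hsm).comp_aemeasurable (hf.prodMk hg)).congr ?_
    filter_upwards [ae_of_ae_map (hf.prodMk hg) hs] with t ht
    simp only [if_pos ht, Function.comp_apply]

/-- Measurable selection of nearest points. -/
theorem exists_aemeasurable_nearest {E : Type*} [MetricSpace E] [PolishSpace E]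
    [MeasurableSpace E] [BorelSpace E] {A : Set E} (hA : IsClosed A)
    (hprox : ∀ x : E, ∃ y ∈ A, dist x y = Metric.infDist x A) {α : Type*} [MeasurableSpace α]
    {μ : Measure α} [IsFiniteMeasure μ] {f : α → E} (hf : AEMeasurable f μ) :
    ∃ p : α → E, AEMeasurable p μ ∧
      ∀ᵐ t ∂μ, p t ∈ A ∧ dist (f t) (p t) = Metric.infDist (f t) A := by
  let Z : Set (E × E) := {z | z.2 ∈ A ∧ dist z.1 z.2 = Metric.infDist z.1 A}
  have hZ : IsClosed Z := (hA.preimage continuous_snd).inter (isClosed_eq (by fun_prop)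
    ((Metric.continuous_infDist_pt A).comp continuous_fst))
  have : PolishSpace Z := hZ.polishSpace
  have he : Continuous fun z : Z ↦ z.1.1 := by fun_prop
  obtain ⟨s, hsm, hs⟩ := exists_measurable_ae_section he
    (fun x ↦ (hprox x).elim fun y hy ↦ ⟨⟨(x, y), hy⟩, rfl⟩) (μ.map f)
  refine ⟨fun t ↦ (s (f t)).1.2, ?_, ?_⟩
  · exact (measurable_snd.comp (measurable_subtype_coe.comp hsm)).comp_aemeasurable hf
  · filter_upwards [ae_of_ae_map hf hs] with t ht
    obtain ⟨hmem, hdist⟩ := (s (f t)).2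
    rw [ht] at hdist
    exact ⟨hmem, hdist⟩

/-! ### Interpolation of subdivisions -/

theorem Set.OrdConnected.Ioo_csInf_csSup_subset {s : Set ℝ} (hs : s.OrdConnected)
    (hne : s.Nonempty) : Ioo (sInf s) (sSup s) ⊆ s := by
  intro t ht
  obtain ⟨x, hx, hxt⟩ := exists_lt_of_csInf_lt hne ht.1
  obtain ⟨y, hy, hty⟩ := exists_lt_of_lt_csSup hne ht.2
  exact hs.out hx hy ⟨hxt.le, hty.le⟩

/-- Endpoints are null, so which of them belong to the interval is irrelevant. -/
theorem Set.OrdConnected.restrict_volume_eq {s : Set ℝ} (hs : s.OrdConnected) (hne : s.Nonempty)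
    (hb : BddBelow s) (ha : BddAbove s) :
    volume.restrict s = volume.restrict (Ioo (sInf s) (sSup s)) := by
  refine Measure.restrict_congr_set (Filter.EventuallyLE.antisymm ?_ ?_)
  · exact (LE.le.eventuallyLE (subset_Icc_csInf_csSup hb ha)).trans
      Ioo_ae_eq_Icc.symm.le
  · exact LE.le.eventuallyLE (hs.Ioo_csInf_csSup_subset hne)

theorem AEMeasurable.comp_add_right_Ioo {E : Type*} [MeasurableSpace E] {a b : ℝ} {F : ℝ → E}
    (hF : AEMeasurable F (volume.restrict (Ioo a b))) (r : ℝ) :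
    AEMeasurable (fun t ↦ F (t + r)) (volume.restrict (Ioo (a - r) (b - r))) := by
  have := (measurePreserving_add_right (volume : Measure ℝ) r).restrict_preimage
    (measurableSet_Ioo (a := a) (b := b))
  rw [preimage_add_const_Ioo] at this
  exact hF.comp_quasiMeasurePreserving this.quasiMeasurePreserving

namespace IsDeltaSubdivision

variable {E : Type*} [MetricSpace E] [MeasurableSpace E] {Δ : ℝ} {J : Set ℝ} {F : ℝ → E}

theorem restrict_eq (h : IsDeltaSubdivision Δ J F) :
    volume.restrict J = volume.restrict (Ioo (sInf J) (sSup J)) :=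
  h.ordConnected.restrict_volume_eq h.nonempty h.bddBelow h.bddAbove

theorem aemeasurable [MeasurableSpace.CountablyGenerated E] (h : IsDeltaSubdivision Δ J F) :
    AEMeasurable F (volume.restrict (Ioo (sInf J) (sSup J))) :=
  h.restrict_eq ▸ h.measurable.aemeasurable

theorem isFiniteMeasure (h : IsDeltaSubdivision Δ J F) : IsFiniteMeasure (volume.restrict J) := by
  rw [h.restrict_eq]
  infer_instance

end IsDeltaSubdivision

theorem IsGeodesicSpace.exists_interpolation {E : Type*} [MetricSpace E] [PolishSpace E]
    [MeasurableSpace E] [BorelSpace E] (hE : IsGeodesicSpace E) {Δ : ℝ} {J K : Set ℝ} {F H : ℝ → E}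
    (hF : IsDeltaSubdivision Δ J F) (hH : IsDeltaSubdivision Δ K H) :
    ∃ 𝒢 : E → E → ℝ → E, (∀ x y, IsConstSpeedGeodesic x y (𝒢 x y)) ∧
      ∀ T ∈ Ioo (0 : ℝ) 1, ∀ I : Set ℝ, I.OrdConnected →
        IsGLB I ((1 - T) * sInf J + T * sInf K) → IsLUB I ((1 - T) * sSup J + T * sSup K) →
        ∃ G : ℝ → E, IsDeltaSubdivision Δ I G ∧ ∀ᵐ t ∂(volume.restrict J),
          G (t + sInf I - sInf J) = 𝒢 (F t) (H (t + sInf K - sInf J)) T := by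
  classical
  have hbJ : sSup J = sInf J + Δ := by linarith [hF.length_eq]
  have hbK : sSup K = sInf K + Δ := by linarith [hH.length_eq]
  have hFm := hF.aemeasurable
  have hHm : AEMeasurable (fun t ↦ H (t + (sInf K - sInf J)))
      (volume.restrict (Ioo (sInf J) (sSup J))) := by
    convert hH.aemeasurable.comp_add_right_Ioo (sInf K - sInf J) using 3 <;> linarith
  obtain ⟨𝒢, h𝒢, hm⟩ := hE.exists_geodesics_aemeasurable hFm hHm
  refine ⟨𝒢, h𝒢, fun T hT I hI hglb hlub ↦ ?_⟩
  have hIne : I.Nonempty := by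
    rw [nonempty_iff_ne_empty]
    rintro rfl
    exact not_isTop _ (isGLB_empty_iff.1 hglb)
  have hinf := hglb.csInf_eq hIne
  have hsup : sSup I = sInf I + Δ := by
    rw [hlub.csSup_eq hIne, hinf, hbJ, hbK]; ring
  obtain ⟨t₀, -⟩ := hF.nonempty
  -- All three intervals have length Δ, hence are translates up to endpoints. The constant default
  -- covers endpoints, where the translated times may leave `J` or `K`.
  let G : ℝ → E := fun t ↦ if t + (sInf J - sInf I) ∈ Ioo (sInf J) (sSup J) then
    𝒢 (F (t + (sInf J - sInf I))) (H (t + (sInf J - sInf I) + (sInf K - sInf J))) T else F t₀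
  have hmem : ∀ t, t ∈ Ioo (sInf I) (sSup I) ↔ t + (sInf J - sInf I) ∈ Ioo (sInf J) (sSup J) := by
    intro t
    simp only [mem_Ioo, hsup, hbJ]
    constructor <;> rintro ⟨h1, h2⟩ <;> constructor <;> linarith
  refine ⟨G, ⟨hIne, hI, hglb.bddBelow, hlub.bddAbove, by rw [hsup]; ring, ?_, ?_⟩, ?_⟩
  · rw [hI.restrict_volume_eq hIne hglb.bddBelow hlub.bddAbove]
    have := (hm T).comp_add_right_Ioo (sInf J - sInf I)
    rw [show sInf J - (sInf J - sInf I) = sInf I by ring,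
      show sSup J - (sInf J - sInf I) = sSup I by rw [hsup, hbJ]; ring] at this
    refine (this.congr ?_).nullMeasurable
    filter_upwards [ae_restrict_mem measurableSet_Ioo] with t ht
    simp only [G, if_pos ((hmem t).1 ht)]
  · obtain ⟨R, hR⟩ := hF.bounded.subset_closedBall (F t₀)
    obtain ⟨S, hS⟩ := hH.bounded.subset_closedBall (F t₀)
    -- A geodesic point is within d(F, H) ≤ R + S of F, and F is within R of the centre; the 0
    -- covers the default value.
    refine (Metric.isBounded_iff_subset_closedBall (F t₀)).2
      ⟨max 0 (R + S + R), ?_⟩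
    rintro _ ⟨t, -, rfl⟩
    simp only [G, Metric.mem_closedBall]
    split_ifs with h
    · have h1 := hR ⟨_, hF.ordConnected.Ioo_csInf_csSup_subset hF.nonempty h, rfl⟩
      have h2 : t + (sInf J - sInf I) + (sInf K - sInf J) ∈ Ioo (sInf K) (sSup K) := by
        rw [hbJ] at h
        rw [hbK]
        constructor <;> linarith [h.1, h.2]
      have h3 := hS ⟨_, hH.ordConnected.Ioo_csInf_csSup_subset hH.nonempty h2, rfl⟩
      rw [Metric.mem_closedBall] at h1 h3
      refine le_max_of_le_right (((dist_triangle _ _ _).trans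
        (add_le_add ((h𝒢 _ _).dist_le ⟨hT.1.le, hT.2.le⟩) h1)).trans ?_)
      gcongr
      exact (dist_triangle_right _ _ _).trans (add_le_add h1 h3)
    · rw [dist_self]
      exact le_max_left _ _
  · rw [hF.restrict_eq]
    filter_upwards [ae_restrict_mem measurableSet_Ioo] with t ht
    have ht' : t + sInf I - sInf J + (sInf J - sInf I) = t := by ring
    simp only [G, ht', if_pos ht]
    rw [add_sub_assoc]

/-- On the exceptional null set `p` may be unbounded, so `G` falls back to `F` there. Elsewhere `G`
stays within d(F, A) of `F`, which is bounded because the distance to A is 1-Lipschitz. -/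
theorem IsGeodesicSpace.exists_interpolation_nearestPoint {E : Type*} [MetricSpace E]
    [PolishSpace E] [MeasurableSpace E] [BorelSpace E] (hE : IsGeodesicSpace E) {Δ : ℝ} {A : Set E}
    {J : Set ℝ} {F p : ℝ → E} (hF : IsDeltaSubdivision Δ J F)
    (hp : IsNearestPointSelection A J F p) :
    ∃ 𝒢 : E → E → ℝ → E, (∀ x y, IsConstSpeedGeodesic x y (𝒢 x y)) ∧
      ∀ T ∈ Ioo (0 : ℝ) 1, ∃ G : ℝ → E, IsDeltaSubdivision Δ J G ∧
        ∀ᵐ t ∂(volume.restrict J), G t = 𝒢 (F t) (p t) T := by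
  classical
  have := hF.isFiniteMeasure
  obtain ⟨𝒢, h𝒢, hm⟩ := hE.exists_geodesics_aemeasurable hF.measurable.aemeasurable
    hp.measurable.aemeasurable
  refine ⟨𝒢, h𝒢, fun T hT ↦ ?_⟩
  let G : ℝ → E := fun t ↦
    if dist (F t) (p t) = Metric.infDist (F t) A then 𝒢 (F t) (p t) T else F t
  have hG : ∀ᵐ t ∂(volume.restrict J), G t = 𝒢 (F t) (p t) T := by
    filter_upwards [hp.nearest] with t ht
    simp only [G, if_pos ht.2]
  refine ⟨G, ⟨hF.nonempty, hF.ordConnected, hF.bddBelow, hF.bddAbove, hF.length_eq, ?_, ?_⟩, hG⟩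
  · exact ((hm T).congr (hG.mono fun t ht ↦ ht.symm)).nullMeasurable
  · obtain ⟨t₀, -⟩ := hF.nonempty
    obtain ⟨R, hR⟩ := hF.bounded.subset_closedBall (F t₀)
    refine (Metric.isBounded_iff_subset_closedBall (F t₀)).2
      ⟨Metric.infDist (F t₀) A + R + R, ?_⟩
    rintro _ ⟨t, ht, rfl⟩
    have h1 : dist (F t) (F t₀) ≤ R := hR ⟨t, ht, rfl⟩
    have h2 : dist (G t) (F t) ≤ Metric.infDist (F t) A := by
      simp only [G]
      split_ifs with h
      · exact ((h𝒢 _ _).dist_le ⟨hT.1.le, hT.2.le⟩).trans h.le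
      · rw [dist_self]; exact Metric.infDist_nonneg
    have h3 := Metric.infDist_le_infDist_add_dist (s := A) (x := F t) (y := F t₀)
    have h4 := dist_triangle (G t) (F t) (F t₀)
    rw [Metric.mem_closedBall]
    linarith

end

theorem mainTheorem6 {E : Type*} [MetricSpace E] [PolishSpace E] [MeasurableSpace E]
    [BorelSpace E] (hE : IsGeodesicSpace E) {Δ : ℝ} (hΔ : 0 < Δ) :
    (∀ (P Q : TVPD E Δ) (i : Fin P.N) (j : Fin Q.N),
      ∃ 𝒢 : E → E → ℝ → E, (∀ x y, IsConstSpeedGeodesic x y (𝒢 x y)) ∧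
        ∀ T ∈ Ioo (0 : ℝ) 1, ∀ I : Set ℝ, I.OrdConnected →
          IsGLB I ((1 - T) * sInf (P.I i) + T * sInf (Q.I j)) →
          IsLUB I ((1 - T) * sSup (P.I i) + T * sSup (Q.I j)) →
          ∃ G : ℝ → E, IsDeltaSubdivision Δ I G ∧
            ∀ᵐ t ∂(volume.restrict (P.I i)),
              G (t + sInf I - sInf (P.I i)) =
                𝒢 (P.toFun t) (Q.toFun (t + sInf (Q.I j) - sInf (P.I i))) T) ∧
    (∀ A : Set E, IsClosed A → (∀ x : E, ∃ y ∈ A, dist x y = Metric.infDist x A) →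
      ∀ (P : TVPD E Δ) (i : Fin P.N),
        (∃ p : ℝ → E, IsNearestPointSelection A (P.I i) P.toFun p) ∧
        ∀ p : ℝ → E, IsNearestPointSelection A (P.I i) P.toFun p →
          ∃ 𝒢 : E → E → ℝ → E, (∀ x y, IsConstSpeedGeodesic x y (𝒢 x y)) ∧
            ∀ T ∈ Ioo (0 : ℝ) 1, ∃ G : ℝ → E, IsDeltaSubdivision Δ (P.I i) G ∧
              ∀ᵐ t ∂(volume.restrict (P.I i)), G t = 𝒢 (P.toFun t) (p t) T) := by
  refine ⟨fun P Q i j ↦ hE.exists_interpolation (P.subdivision i) (Q.subdivision j),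
    fun A hA hprox P i ↦
      ⟨?_, fun p hp ↦ hE.exists_interpolation_nearestPoint (P.subdivision i) hp⟩⟩
  have := (P.subdivision i).isFiniteMeasure
  obtain ⟨p, hpm, hp⟩ :=
    exists_aemeasurable_nearest hA hprox (P.subdivision i).measurable.aemeasurable
  exact ⟨p, hpm.nullMeasurable, hp⟩
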